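/- Let $m,n$ be positive integers and let $G$ be a non-solvable finite group generated by elements $g$ and $h$ of orders $m$ and $n$ with $(gh)^2=1$ (a $(2,m,n)$-group). Suppose that its Euler characteristic $$\chi=|G|\left(\frac1m-\frac12+\frac1n\right)$$ equals $2^a$ or $-2^a$ for some integer $a\ge 0$. Let $O_2(G)$ be the largest normal $2$-subgroup of $G$ and put $\overline G=G/O_2(G)$. Then there are an integer $k\geq 1$, a group $M$ and non-abelian simple groups $T_1,\dots,T_k$ such that $\overline G$ has a normal subgroup $N\cong M\times T_1\times\cdots\times T_k$, where - $F^*(M)$ is cyclic of odd order; - for all $i\ne j$, $\gcd(|T_i|,|T_j|)$ is a power of $2$ (possibly $1$); - $\overline G/N$ is isomorphic to a subgroup of $\mathrm{Out}(T_1\times\cdots\times T_k)$. Here $F^*(M)=F(M)E(M)$ is the generalized Fitting subgroup: $F(M)$ is the Fitting subgroup (generated by all nilpotent normal subgroups), and $E(M)$ is generated by all quasisimple subnormal subgroups, where a group $L$ is quasisimple if it is perfect and $L/Z(L)$ is simple. Also $\mathrm{Out}(K)=\mathrm{Aut}(K)/\mathrm{Inn}(K)$. -/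

import Mathlib

universe u

/-- `(G, g, h)` is a `(2, m, n)`-group: `m, n` are positive, `G` is generated by `g` and `h`,
these have orders exactly `m` and `n`, and `(g * h) ^ 2 = 1`. Equivalently, `G` is a quotient of
`⟨x, y | x ^ m = y ^ n = (x * y) ^ 2 = 1⟩` in which the images of `x, y` have orders `m, n`. -/
structure IsTwoMNGroup {G : Type*} [Group G] (g h : G) (m n : ℕ) : Prop where
  m_pos : 0 < m
  n_pos : 0 < n
  orderOf_left : orderOf g = m
  orderOf_right : orderOf h = n
  mul_sq : (g * h) ^ 2 = 1
  generates : Subgroup.closure {g, h} = ⊤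

/-- The Euler characteristic `|G| (1/m - 1/2 + 1/n)` of a finite `(2, m, n)`-group `G`. -/
noncomputable def eulerCharTwoMN (G : Type*) [Group G] (m n : ℕ) : ℚ :=
  (Nat.card G : ℚ) * (1 / (m : ℚ) - 1 / 2 + 1 / (n : ℚ))

/-- `O_p(K)`: the subgroup generated by all normal `p`-subgroups of `K`. For finite `K` and
prime `p` it is the largest normal `p`-subgroup (see `isPGroup_pCore`). -/
def pCore (p : ℕ) (K : Type*) [Group K] : Subgroup K :=
  sSup {N : Subgroup K | N.Normal ∧ IsPGroup p N}

instance pCore_normal (p : ℕ) (K : Type*) [Group K] : (pCore p K).Normal :=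
  Subgroup.sSup_normal _ fun _ hN => hN.1

theorem isPGroup_pCore (p : ℕ) [Fact p.Prime] (K : Type*) [Group K] [Finite K] :
    IsPGroup p (pCore p K) := by
  obtain ⟨N, ⟨hN, hp⟩, hmax⟩ :=
    (Set.toFinite {N : Subgroup K | N.Normal ∧ IsPGroup p N}).exists_maximal
      ⟨⊥, inferInstance, IsPGroup.of_bot⟩
  have : pCore p K = N := by
    refine le_antisymm (sSup_le fun L hL => ?_) (le_sSup ⟨hN, hp⟩)
    have h1 : N ⊔ L ∈ {N : Subgroup K | N.Normal ∧ IsPGroup p N} :=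
      ⟨@Subgroup.sup_normal _ _ N L hN hL.1, @IsPGroup.to_sup_of_normal_right _ _ _ N L hp hL.2 hL.1⟩
    exact le_sup_right.trans (hmax h1 le_sup_left)
  rw [this]; exact hp

/-- A group is quasisimple if it is perfect and its central quotient is simple. -/
def IsQuasisimple (L : Type*) [Group L] : Prop :=
  Group.IsPerfect L ∧ IsSimpleGroup (L ⧸ Subgroup.center L)

/-- The Fitting subgroup `F(K)`: the subgroup generated by all nilpotent normal subgroups. -/
def fittingSubgroup (K : Type*) [Group K] : Subgroup K :=
  sSup {N : Subgroup K | N.Normal ∧ Group.IsNilpotent N}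

/-- The layer `E(K)`: the subgroup generated by all quasisimple subnormal subgroups. -/
def layerSubgroup (K : Type*) [Group K] : Subgroup K :=
  sSup {L : Subgroup K | L.IsSubnormal ∧ IsQuasisimple L}

/-- The generalized Fitting subgroup `F*(K) = F(K) E(K)`, generated by `F(K)` and `E(K)`. -/
def genFittingSubgroup (K : Type*) [Group K] : Subgroup K :=
  fittingSubgroup K ⊔ layerSubgroup K

/-- The group `Inn(K)` of inner automorphisms, as a subgroup of `Aut(K)`. -/
def innSubgroup (K : Type*) [Group K] : Subgroup (MulAut K) :=
  (MulAut.conj (G := K)).range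

instance innSubgroup_normal (K : Type*) [Group K] : (innSubgroup K).Normal where
  conj_mem := by
    rintro _ ⟨x, rfl⟩ a
    refine ⟨a x, ?_⟩
    ext y
    simp [MulAut.conj_apply]

/-- The outer automorphism group `Out(K) = Aut(K) / Inn(K)`. -/
abbrev OutGroup (K : Type*) [Group K] : Type _ :=
  MulAut K ⧸ innSubgroup K

open Subgroup

/-! Clearing denominators gives |G| (2m + 2n - mn) = ±2^(a+1) mn. For odd p, the factor 2m + 2n - mn
is divisible by the smaller of the p-parts of m and n, so the p-part of |G| is at most the larger
one. Hence `g` or `h` has order divisible by the full p-part of |G|, and the odd Sylow subgroups are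
cyclic.

This passes to K = G/O_2(G), where O_2(K) = 1. Nilpotent subnormal subgroups of K are then cyclic of
odd order, and transfer shows that quasisimple subnormal subgroups have trivial centre, so they are
simple. Distinct ones commute, and their join E is their direct product. Take M = C_K(E) and N = M ×
E. A component of M would lie in E and be centralized by itself, so F*(M) = F(M) is cyclic of odd
order. An odd prime dividing |T_i| and |T_j| would give a noncyclic subgroup of order p².
Conjugation embeds K/N in Out(E). A minimal non-solvable subnormal subgroup is a component, whence k
≥ 1. -/

/-- Every subgroup of odd prime power order is cyclic. -/
def OddPSubgroupsCyclic (K : Type*) [Group K] : Prop :=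
  ∀ p : ℕ, p.Prime → p ≠ 2 → ∀ P : Subgroup K, IsPGroup p P → IsCyclic P

/-! ### Cyclicity of odd p-subgroups -/

theorem OddPSubgroupsCyclic.of_injective {A B : Type*} [Group A] [Group B]
    (hB : OddPSubgroupsCyclic B) (f : A →* B) (hf : Function.Injective f) :
    OddPSubgroupsCyclic A := fun p hp hp2 P hP => by
  have := hB p hp hp2 _ (hP.map f)
  exact (P.equivMapOfInjective f hf).isCyclic.mpr this

theorem OddPSubgroupsCyclic.subgroup {K : Type*} [Group K] (hK : OddPSubgroupsCyclic K)
    (H : Subgroup K) : OddPSubgroupsCyclic H :=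
  hK.of_injective H.subtype H.subtype_injective

theorem OddPSubgroupsCyclic.of_surjective {A B : Type*} [Group A] [Group B] [Finite A]
    (hA : OddPSubgroupsCyclic A) (f : A →* B) (hf : Function.Surjective f) :
    OddPSubgroupsCyclic B := fun p hp hp2 P hP => by
  have := Fact.mk hp
  obtain ⟨Q, hQ⟩ := hP.exists_le_sylow
  obtain ⟨R, rfl⟩ := Sylow.mapSurjective_surjective hf p Q
  have := hA p hp hp2 _ R.2
  have hc : IsCyclic (R.map f) :=
    isCyclic_of_surjective _ (f.subgroupMap_surjective R)
  exact isCyclic_of_le (H' := (R : Subgroup A).map f) hQ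

theorem OddPSubgroupsCyclic.of_le_max_factorization {G : Type*} [Group G] [Finite G] (g h : G)
    (H : ∀ p : ℕ, p.Prime → p ≠ 2 → (Nat.card G).factorization p ≤
      max ((orderOf g).factorization p) ((orderOf h).factorization p)) :
    OddPSubgroupsCyclic G := fun p hp hp2 P hP => by
  have := Fact.mk hp
  obtain ⟨x, hx⟩ : ∃ x : G, (Nat.card G).factorization p = (orderOf x).factorization p := by
    have h1 : ∀ x : G, (orderOf x).factorization p ≤ (Nat.card G).factorization p := fun x =>
      (Nat.factorization_le_iff_dvd (orderOf_pos x).ne' Nat.card_pos.ne').mpr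
        (orderOf_dvd_natCard x) p
    rcases le_max_iff.mp (H p hp hp2) with h2 | h2
    · exact ⟨g, le_antisymm h2 (h1 g)⟩
    · exact ⟨h, le_antisymm h2 (h1 h)⟩
  -- `y` generates the p-part of `zpowers x`, which is a full Sylow subgroup.
  set y := x ^ (orderOf x / p ^ (orderOf x).factorization p) with hy
  have hyo : orderOf y = p ^ (Nat.card G).factorization p := by
    rw [hx, hy, orderOf_pow_of_dvd (Nat.ordCompl_pos p (orderOf_pos x).ne').ne'
      (Nat.ordCompl_dvd _ p)]
    exact Nat.div_div_self (Nat.ordProj_dvd _ p) (orderOf_pos x).ne'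
  obtain ⟨Q, hQ⟩ := hP.exists_le_sylow
  let R : Sylow p G := Sylow.ofCard (zpowers y) (by rw [Nat.card_zpowers, hyo])
  have hR : IsCyclic R := inferInstanceAs (IsCyclic (zpowers y))
  have hQc : IsCyclic Q := (Q.equiv R).isCyclic.mpr hR
  exact isCyclic_of_le hQ

theorem eulerCharTwoMN_eq_iff {G : Type*} [Group G] [Finite G] {m n : ℕ} (hm : 0 < m) (hn : 0 < n)
    (c : ℤ) : eulerCharTwoMN G m n = c ↔
      (Nat.card G : ℤ) * (2 * m + 2 * n - m * n) = 2 * c * (m * n) := by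
  have hm' : (m : ℚ) ≠ 0 := by positivity
  have hn' : (n : ℚ) ≠ 0 := by positivity
  rw [← @Int.cast_inj ℚ, eulerCharTwoMN]
  push_cast
  constructor
  · intro h
    rw [← h]
    field_simp
    ring
  · intro h
    field_simp
    linarith

theorem factorization_card_le_max {G : Type*} [Group G] [Finite G] {m n a : ℕ} (hm : 0 < m)
    (hn : 0 < n) (hχ : eulerCharTwoMN G m n = 2 ^ a ∨ eulerCharTwoMN G m n = -2 ^ a)
    {p : ℕ} (hp : p.Prime) (hp2 : p ≠ 2) :
    (Nat.card G).factorization p ≤ max (m.factorization p) (n.factorization p) := by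
  have h1 : ((Nat.card G : ℤ) * (2 * m + 2 * n - m * n)).natAbs = 2 ^ (a + 1) * (m * n) := by
    rcases hχ with h | h
    · rw [(eulerCharTwoMN_eq_iff hm hn (2 ^ a)).mp (by push_cast; exact h)]
      simp [Int.natAbs_mul, Int.natAbs_pow, pow_succ']
    · rw [(eulerCharTwoMN_eq_iff hm hn (-2 ^ a)).mp (by push_cast; exact h)]
      simp [Int.natAbs_mul, Int.natAbs_pow, pow_succ']
  set v := (Nat.card G).factorization p
  set i := m.factorization p
  set j := n.factorization p
  have hmi : p ^ min i j ∣ m := (pow_dvd_pow p (min_le_left _ _)).trans (Nat.ordProj_dvd m p)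
  have hnj : p ^ min i j ∣ n := (pow_dvd_pow p (min_le_right _ _)).trans (Nat.ordProj_dvd n p)
  have h2 : ((p ^ min i j : ℕ) : ℤ) ∣ 2 * m + 2 * n - m * n := by
    have hmi' := Int.natCast_dvd_natCast.mpr hmi
    have hnj' := Int.natCast_dvd_natCast.mpr hnj
    exact dvd_sub (dvd_add (hmi'.mul_left 2) (hnj'.mul_left 2)) (hmi'.mul_right _)
  have h3 : p ^ (v + min i j) ∣ 2 ^ (a + 1) * (m * n) := by
    rw [← h1, Int.natAbs_mul, pow_add, Int.natAbs_natCast]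
    exact mul_dvd_mul (Nat.ordProj_dvd _ p) (Int.natCast_dvd.mp h2)
  have h4 : p ^ (v + min i j) ∣ m * n :=
    (((Nat.coprime_primes hp Nat.prime_two).mpr hp2).pow _ _).dvd_of_dvd_mul_left h3
  rw [hp.pow_dvd_iff_le_factorization (by positivity),
    Nat.factorization_mul hm.ne' hn.ne', Finsupp.add_apply] at h4
  have : min i j + max i j = i + j := min_add_max i j
  omega

theorem IsTwoMNGroup.oddPSubgroupsCyclic {G : Type*} [Group G] [Finite G] {g h : G} {m n a : ℕ}
    (hgh : IsTwoMNGroup g h m n)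
    (hχ : eulerCharTwoMN G m n = 2 ^ a ∨ eulerCharTwoMN G m n = -2 ^ a) :
    OddPSubgroupsCyclic G :=
  .of_le_max_factorization g h fun _ hp hp2 => by
    rw [hgh.orderOf_left, hgh.orderOf_right]
    exact factorization_card_le_max hgh.m_pos hgh.n_pos hχ hp hp2

/-! ### The `p`-core -/

theorem le_pCore {p : ℕ} {K : Type*} [Group K] {N : Subgroup K} (hN : N.Normal)
    (hp : IsPGroup p N) : N ≤ pCore p K := le_sSup ⟨hN, hp⟩

section pCore
variable {p : ℕ} [Fact p.Prime] {A B K : Type*} [Group A] [Group B] [Group K]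
  [Finite A] [Finite K]

theorem map_pCore_le (f : A →* B) (hf : Function.Surjective f) :
    (pCore p A).map f ≤ pCore p B :=
  le_pCore ((pCore_normal p A).map f hf) ((isPGroup_pCore p A).map f)

instance pCore_characteristic : (pCore p A).Characteristic :=
  characteristic_iff_map_le.mpr fun e => map_pCore_le e.toMonoidHom e.surjective

/-- The p-core of a normal subgroup is characteristic in it, hence normal in the larger group;
descend a subnormal chain. -/
theorem pCore_eq_bot_of_isSubnormal (hK : pCore p K = ⊥) {H : Subgroup K} (hH : H.IsSubnormal) :
    pCore p H = ⊥ := by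
  induction hH with
  | top =>
    have := map_pCore_le (p := p) (A := (⊤ : Subgroup K)) (B := K) (topEquiv (G := K)).toMonoidHom
      (topEquiv (G := K)).surjective
    rw [hK, le_bot_iff] at this
    exact (map_eq_bot_iff_of_injective _ topEquiv.injective).mp this
  | step H L hle _ hN ih =>
    have h1 : pCore p (H.subgroupOf L) = ⊥ := by
      have : (pCore p (H.subgroupOf L)).map (H.subgroupOf L).subtype ≤ pCore p L :=
        le_pCore inferInstance ((isPGroup_pCore p _).map _)
      rw [ih, le_bot_iff] at this
      exact (map_eq_bot_iff_of_injective _ (subtype_injective _)).mp this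
    let e := (subgroupOfEquivOfLe hle).symm
    have := map_pCore_le (p := p) e.toMonoidHom e.surjective
    rw [h1, le_bot_iff] at this
    exact (map_eq_bot_iff_of_injective _ e.injective).mp this

theorem pCore_quotient_pCore : pCore p (K ⧸ pCore p K) = ⊥ := by
  have hker : IsPGroup p (QuotientGroup.mk' (pCore p K)).ker := by
    rw [QuotientGroup.ker_mk']; exact isPGroup_pCore p K
  have h1 := le_pCore ((pCore_normal p (K ⧸ pCore p K)).comap (QuotientGroup.mk' (pCore p K)))
    ((isPGroup_pCore p (K ⧸ pCore p K)).comap_of_ker_isPGroup _ hker)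
  have h2 := map_mono (f := QuotientGroup.mk' (pCore p K)) h1
  rw [map_comap_eq_self_of_surjective (QuotientGroup.mk'_surjective _),
    QuotientGroup.map_mk'_self, le_bot_iff] at h2
  exact h2

end pCore

/-! ### Nilpotent groups with trivial 2-core -/

theorem isCyclic_and_odd_card_of_isNilpotent {A : Type*} [Group A] [Finite A]
    [hn : Group.IsNilpotent A] (hA : OddPSubgroupsCyclic A) (h2 : pCore 2 A = ⊥) :
    IsCyclic A ∧ Odd (Nat.card A) := by
  have hSyl := ((Group.isNilpotent_of_finite_tfae (G := A)).out 0 3).mp hn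
  have htwo (P : Sylow 2 A) : (P : Subgroup A) = ⊥ := by
    rw [← le_bot_iff, ← h2]
    exact le_pCore (hSyl 2 inferInstance P) P.2
  have : IsZGroup A := ⟨fun p hp P => by
    by_cases hp2 : p = 2
    · subst hp2
      have := htwo P
      rw [show (P : Subgroup A) = ⊥ from this]
      infer_instance
    · exact hA p hp hp2 P P.2⟩
  -- A nilpotent group with all Sylow subgroups cyclic is cyclic.
  refine ⟨inferInstance, ?_⟩
  have P : Sylow 2 A := default
  have := P.not_dvd_index
  rw [htwo P, index_bot] at this
  exact Nat.not_even_iff_odd.mp fun h => this h.two_dvd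

theorem isNilpotent_of_commutator_le_centralizer {K : Type*} [Group K] {Y : Subgroup K}
    (h : ⁅Y, Y⁆ ≤ centralizer Y) : Group.IsNilpotent Y :=
  isNilpotent_of_lowerCentralSeries_eq_bot (n := 2) <| by
    simpa [Subgroup.lowerCentralSeries_succ] using commutator_eq_bot_iff_le_centralizer.mpr h

/-- The abelian case of Fitting's theorem: the commutator subgroup of AB lies in A ∩ B, which both A
and B centralize, so the class is at most 2. -/
theorem isNilpotent_sup_of_isMulCommutative {K : Type*} [Group K] {A B : Subgroup K} [A.Normal]
    [B.Normal] (hA : A ≤ centralizer A) (hB : B ≤ centralizer B) :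
    Group.IsNilpotent (A ⊔ B : Subgroup K) := by
  refine isNilpotent_of_commutator_le_centralizer ?_
  have key : ∀ {A B : Subgroup K} [A.Normal] [B.Normal], B ≤ centralizer B →
      ⁅A ⊔ B, A ⊔ B⁆ ≤ A := by
    intro A B _ _ hB
    rw [commutator_le]
    intro x hx y hy
    rw [← QuotientGroup.eq_one_iff, ← QuotientGroup.mk'_apply, map_commutatorElement,
      commutatorElement_eq_one_iff_commute]
    have h1 : ∀ z ∈ A ⊔ B, ∃ b ∈ B, QuotientGroup.mk' A z = QuotientGroup.mk' A b := by
      intro z hz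
      obtain ⟨a, ha, b, hb, rfl⟩ := mem_sup_of_normal_left.mp hz
      exact ⟨b, hb, by simp [(QuotientGroup.eq_one_iff a).mpr ha]⟩
    obtain ⟨b, hb, hxb⟩ := h1 x hx
    obtain ⟨c, hc, hyc⟩ := h1 y hy
    rw [hxb, hyc]
    exact (show Commute b c from mem_centralizer_iff.mp (hB hc) b hb).map _
  have h1 : ⁅A ⊔ B, A ⊔ B⁆ ≤ A := key hB
  have h2 : ⁅A ⊔ B, A ⊔ B⁆ ≤ B := by rw [sup_comm]; exact key hA
  rw [le_centralizer_iff]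
  exact sup_le (hA.trans (centralizer_le h1)) (hB.trans (centralizer_le h2))

theorem isNilpotent_fittingSubgroup {K : Type*} [Group K] [Finite K]
    (h : ∀ N : Subgroup K, N.Normal → Group.IsNilpotent N → N ≤ centralizer N) :
    Group.IsNilpotent (fittingSubgroup K) := by
  obtain ⟨N, ⟨hN, hn⟩, hmax⟩ :=
    (Set.toFinite {N : Subgroup K | N.Normal ∧ Group.IsNilpotent N}).exists_maximal
      ⟨⊥, inferInstance, inferInstance⟩
  have : fittingSubgroup K = N := by
    refine le_antisymm (sSup_le fun L hL => ?_) (le_sSup ⟨hN, hn⟩)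
    have := hL.1
    exact le_sup_right.trans (hmax ⟨sup_normal N L, isNilpotent_sup_of_isMulCommutative
      (h N hN hn) (h L hL.1 hL.2)⟩ le_sup_left)
  rw [this]; exact hn

theorem le_centralizer_of_isCyclic {K : Type*} [Group K] (N : Subgroup K) [IsCyclic N] :
    N ≤ centralizer N := by
  intro x hx
  rw [mem_centralizer_iff]
  intro y hy
  exact congrArg Subtype.val (IsCyclic.isMulCommutative.is_comm.comm (⟨y, hy⟩ : N) ⟨x, hx⟩)

instance fittingSubgroup_normal (K : Type*) [Group K] : (fittingSubgroup K).Normal :=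
  sSup_normal _ fun _ h => h.1

theorem isCyclic_and_odd_of_isSubnormal_of_isNilpotent {K : Type*} [Group K] [Finite K]
    (hK : OddPSubgroupsCyclic K) (h2 : pCore 2 K = ⊥) {N : Subgroup K} (hN : N.IsSubnormal)
    (hn : Group.IsNilpotent N) : IsCyclic N ∧ Odd (Nat.card N) :=
  isCyclic_and_odd_card_of_isNilpotent (hK.subgroup N) (pCore_eq_bot_of_isSubnormal h2 hN)

theorem isCyclic_and_odd_card_fittingSubgroup {K : Type*} [Group K] [Finite K]
    (hK : OddPSubgroupsCyclic K) (h2 : pCore 2 K = ⊥) :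
    IsCyclic (fittingSubgroup K) ∧ Odd (Nat.card (fittingSubgroup K)) := by
  refine isCyclic_and_odd_of_isSubnormal_of_isNilpotent hK h2
    (fittingSubgroup_normal K).isSubnormal (isNilpotent_fittingSubgroup fun N hN hn => ?_)
  have := (isCyclic_and_odd_of_isSubnormal_of_isNilpotent hK h2 hN.isSubnormal hn).1
  exact le_centralizer_of_isCyclic N

/-! ### Quasisimple subnormal subgroups are simple -/

open scoped IsMulCommutative in
-- Transfer into the abelian group `P` sends a central `z` to `z` to the power of the index of `P`,
-- yet it is trivial on a perfect group. The index is prime to the order of `z`.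
theorem eq_one_of_mem_sylow_of_mem_center {X : Type*} [Group X] [Finite X] [hX : Group.IsPerfect X]
    {p : ℕ} [Fact p.Prime] (P : Sylow p X) [IsMulCommutative P] {z : X} (hzP : z ∈ P)
    (hz : z ∈ center X) : z = 1 := by
  have h1 := MonoidHom.transfer_eq_pow (MonoidHom.id P) z fun k g _ => by
    rw [mul_assoc, mem_center_iff.mp (pow_mem hz k) g |>.symm, inv_mul_cancel_left]
  have h2 : (MonoidHom.transfer (MonoidHom.id P)) z = 1 :=
    Abelianization.commutator_subset_ker _ (Group.IsPerfect.mem_commutator (g := z))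
  rw [h2] at h1
  have h3 : z ^ (P : Subgroup X).index = 1 := (congrArg Subtype.val h1).symm
  have hcop : (Nat.card P).Coprime (P : Subgroup X).index := P.card_coprime_index
  exact orderOf_eq_one_iff.mp <| Nat.eq_one_of_dvd_coprimes hcop
    (orderOf_dvd_natCard _ hzP) (orderOf_dvd_of_pow_eq_one h3)

theorem center_eq_bot_of_isPerfect {X : Type*} [Group X] [Finite X] [Group.IsPerfect X]
    (hX : OddPSubgroupsCyclic X) (h2 : pCore 2 X = ⊥) : center X = ⊥ := by
  have hodd := (isCyclic_and_odd_of_isSubnormal_of_isNilpotent hX h2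
    (inferInstance : (center X).Normal).isSubnormal (isNilpotent_of_commutator_le_centralizer
      ((center X).commutator_le_self.trans (center_le_centralizer _)))).2
  by_contra hne
  have hcard : Nat.card (center X) ≠ 1 := fun h => hne (card_eq_one.mp h)
  obtain ⟨p, hp, hdvd⟩ := Nat.exists_prime_and_dvd hcard
  have := Fact.mk hp
  have hp2 : p ≠ 2 := by
    rintro rfl
    exact Nat.not_even_iff_odd.mpr hodd (even_iff_two_dvd.mpr hdvd)
  obtain ⟨z, hz⟩ := exists_prime_orderOf_dvd_card' p hdvd
  have hpz : IsPGroup p (zpowers (z : X)) := IsPGroup.of_card (n := 1) <| by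
    rw [Nat.card_zpowers, orderOf_coe, hz, pow_one]
  obtain ⟨P, hP⟩ := hpz.exists_le_sylow
  have := hX p hp hp2 P P.2
  have := eq_one_of_mem_sylow_of_mem_center P (hP (mem_zpowers _)) z.2
  rw [← orderOf_eq_one_iff, orderOf_coe, hz] at this
  exact hp.one_lt.ne' this

theorem IsQuasisimple.isSimpleGroup {X : Type*} [Group X] [Finite X] (h : IsQuasisimple X)
    (hX : OddPSubgroupsCyclic X) (h2 : pCore 2 X = ⊥) :
    IsSimpleGroup X ∧ ¬ Group.IsSolvable X := by
  have := h.1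
  have := h.2
  have : IsSimpleGroup X :=
    (((QuotientGroup.quotientMulEquivOfEq (center_eq_bot_of_isPerfect hX h2)).trans
      QuotientGroup.quotientBot).symm).isSimpleGroup
  exact ⟨this, Group.IsPerfect.not_isSolvable X⟩

/-! ### Components of groups with simple components -/

/-- The non-abelian simple subnormal subgroups. -/
def simpleComponents (K : Type*) [Group K] : Set (Subgroup K) :=
  {L | L.IsSubnormal ∧ IsSimpleGroup L ∧ ¬ Group.IsSolvable L}

theorem commutator_self_eq_of_isSimpleGroup {K : Type*} [Group K] {T : Subgroup K}
    [IsSimpleGroup T] (hT : ¬ Group.IsSolvable T) : ⁅T, T⁆ = T := by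
  rw [← isPerfect_iff, Group.isPerfect_def]
  refine (Normal.eq_bot_or_eq_top (inferInstance : (commutator T).Normal)).resolve_left fun h => ?_
  exact hT (Group.isSolvable_of_comm fun a b => by
    rw [← commutatorElement_eq_one_iff_mul_comm, ← mem_bot, ← h]
    exact commutator_mem_commutator (mem_top a) (mem_top b))

/-- The three subgroups lemma gives [[T,T],X] = 1, and T is perfect. -/
theorem commutator_eq_bot_of_commutator_commutator_eq_bot {K : Type*} [Group K] {T X : Subgroup K}
    (hT : ⁅T, T⁆ = T) (h : ⁅⁅X, T⁆, T⁆ = ⊥) : ⁅X, T⁆ = ⊥ := by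
  have := commutator_commutator_eq_bot_of_rotate (H₁ := T) (H₂ := T) (H₃ := X)
    (by rwa [commutator_comm T X]) h
  rwa [hT, commutator_comm] at this

/-- If H is normal in L, then [N ∩ L, T] ≤ N ∩ H, so T centralizes [N ∩ L, T] and the previous lemma
lifts the conclusion from H to L. Iterate up the subnormal chain to the whole group. -/
theorem commutator_eq_bot_of_inf_commutator_eq_bot {K : Type*} [Group K] {T N H : Subgroup K}
    (hT : ⁅T, T⁆ = T) (hN : T ≤ normalizer (N : Set K)) (hH : H.IsSubnormal) (hTH : T ≤ H)
    (h : ⁅N ⊓ H, T⁆ = ⊥) : ⁅N, T⁆ = ⊥ := by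
  induction hH with
  | top => simpa using h
  | step H L hle _ hHL ih =>
    refine ih (hTH.trans hle) ?_
    rw [normal_subgroupOf_iff_le_normalizer hle, le_normalizer_iff_commutator_le_right] at hHL
    refine commutator_eq_bot_of_commutator_commutator_eq_bot hT (le_bot_iff.mp ?_)
    rw [← h]
    refine commutator_mono (le_inf ?_ ?_) le_rfl
    · exact (commutator_mono inf_le_left le_rfl).trans
        (le_normalizer_iff_commutator_le_left.mp hN)
    · exact (commutator_mono inf_le_right hTH).trans hHL

theorem le_or_commutator_eq_bot {K : Type*} [Group K] {T : Subgroup K}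
    (hT : T ∈ simpleComponents K) {H : Subgroup K} (hH : H.IsSubnormal) :
    T ≤ H ∨ ⁅H, T⁆ = ⊥ := by
  obtain ⟨hTs, hTsimple, hTsol⟩ := hT
  induction hH with
  | top => exact .inl le_top
  | step H L hle _ hHL ih =>
    rcases ih with h | h
    · rw [normal_subgroupOf_iff_le_normalizer hle] at hHL
      have hnorm : T ≤ normalizer (H : Set K) := h.trans hHL
      have : (H.subgroupOf T).Normal := normal_subgroupOf_of_le_normalizer hnorm
      -- T normalizes H, so simplicity leaves T ∩ H = 1 or T ≤ H.
      rcases this.eq_bot_or_eq_top with h0 | h1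
      · right
        rw [subgroupOf_eq_bot] at h0
        refine commutator_eq_bot_of_inf_commutator_eq_bot
          (commutator_self_eq_of_isSimpleGroup hTsol) hnorm hTs le_rfl ?_
        rw [h0.eq_bot, commutator_bot_left]
      · exact .inl (subgroupOf_eq_top.mp h1)
    · exact .inr (le_bot_iff.mp (h ▸ commutator_mono hle le_rfl))

theorem commutator_eq_bot_of_mem_simpleComponents {K : Type*} [Group K] {S T : Subgroup K}
    (hS : S ∈ simpleComponents K) (hT : T ∈ simpleComponents K) (hne : S ≠ T) : ⁅S, T⁆ = ⊥ := by
  rcases le_or_commutator_eq_bot hT hS.1 with h1 | h1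
  · rcases le_or_commutator_eq_bot hS hT.1 with h2 | h2
    · exact absurd (le_antisymm h2 h1) hne
    · rwa [commutator_comm]
  · exact h1

/-! ### Existence of components -/

/-- The automorphism group of a cyclic group is abelian, so a perfect group acts trivially on N. -/
theorem le_center_of_isCyclic_of_normal {X : Type*} [Group X] [Group.IsPerfect X] {N : Subgroup X}
    [N.Normal] [IsCyclic N] : N ≤ center X := by
  let f : X →* (ZMod (Nat.card N))ˣ :=
    (IsCyclic.mulAutMulEquiv N).toMonoidHom.comp MulAut.conjNormal
  intro x hx
  rw [mem_center_iff]
  intro g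
  have h1 : f g = 1 := Abelianization.commutator_subset_ker f Group.IsPerfect.mem_commutator
  have h2 : (MulAut.conjNormal g : MulAut N) = 1 :=
    (IsCyclic.mulAutMulEquiv N).injective (h1.trans (map_one _).symm)
  have h3 := congrArg Subtype.val (DFunLike.congr_fun h2 ⟨x, hx⟩)
  rw [MulAut.conjNormal_apply] at h3
  exact mul_inv_eq_iff_eq_mul.mp h3

theorem commutator_self_lt_of_isSolvable {K : Type*} [Group K] {N : Subgroup K}
    [Group.IsSolvable N] (h : N ≠ ⊥) : ⁅N, N⁆ < N := by
  refine lt_of_le_of_ne N.commutator_le_self fun he => ?_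
  have : Group.IsPerfect N := isPerfect_iff.mpr he
  have : Nontrivial N := (nontrivial_iff_ne_bot N).mpr h
  exact Group.IsPerfect.not_isSolvable N inferInstance

/-- By induction [N,N] is central, so N is nilpotent, hence cyclic, hence central. -/
theorem le_center_of_isSolvable_of_normal {X : Type*} [Group X] [Finite X] [Group.IsPerfect X]
    (hX : OddPSubgroupsCyclic X) (h2 : pCore 2 X = ⊥) (N : Subgroup X) (hN : N.Normal)
    (hs : Group.IsSolvable N) : N ≤ center X := by
  induction N using WellFoundedLT.induction with | ind N ih =>
  rcases eq_or_ne N ⊥ with rfl | hne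
  · exact bot_le
  have hle : ⁅N, N⁆ ≤ N := N.commutator_le_self
  have h1 : ⁅N, N⁆ ≤ center X := ih _ (commutator_self_lt_of_isSolvable hne) inferInstance
    (Group.isSolvable_of_isSolvable_injective (inclusion_injective hle))
  have := (isCyclic_and_odd_of_isSubnormal_of_isNilpotent hX h2 hN.isSubnormal
    (isNilpotent_of_commutator_le_centralizer (h1.trans (center_le_centralizer _)))).1
  exact le_center_of_isCyclic_of_normal

theorem isQuasisimple_of_forall_isSolvable {X : Type*} [Group X] [Finite X] [Nontrivial X]
    (hperf : Group.IsPerfect X) (hX : OddPSubgroupsCyclic X) (h2 : pCore 2 X = ⊥)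
    (hs : ∀ N : Subgroup X, N.Normal → N ≠ ⊤ → Group.IsSolvable N) : IsQuasisimple X := by
  have hnt : Nontrivial (X ⧸ center X) := by
    rw [QuotientGroup.nontrivial_iff]
    intro h
    refine Group.IsPerfect.not_isSolvable X (Group.isSolvable_of_comm fun a b => ?_)
    exact (mem_center_iff.mp (h ▸ mem_top b : b ∈ center X) a)
  refine ⟨hperf, ⟨fun N hN => ?_⟩⟩
  by_cases h : N.comap (QuotientGroup.mk' (center X)) = ⊤
  · right
    rw [← map_comap_eq_self_of_surjective (QuotientGroup.mk'_surjective (center X)) N, h,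
      map_top_of_surjective _ (QuotientGroup.mk'_surjective _)]
  · left
    have h1 := le_center_of_isSolvable_of_normal hX h2 _ (hN.comap _) (hs _ (hN.comap _) h)
    rw [← map_comap_eq_self_of_surjective (QuotientGroup.mk'_surjective (center X)) N,
      ← le_bot_iff]
    refine (map_mono h1).trans ?_
    rw [QuotientGroup.map_mk'_self]

theorem simpleComponents_nonempty {K : Type*} [Group K] [Finite K] (hK : OddPSubgroupsCyclic K)
    (h2 : pCore 2 K = ⊥) (hns : ¬ Group.IsSolvable K) : (simpleComponents K).Nonempty := by
  -- By minimality the proper normal subgroups of `X` are solvable. This makes `X` perfect, since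
  -- otherwise its commutator subgroup, and so `X`, would be solvable.
  obtain ⟨X, ⟨hXs, hXn⟩, hmin⟩ :=
    (Set.toFinite {X : Subgroup K | X.IsSubnormal ∧ ¬ Group.IsSolvable X}).exists_minimal
      ⟨⊤, .top, fun h => hns
        (Group.isSolvable_of_surjective (f := (topEquiv (G := K)).toMonoidHom) topEquiv.surjective)⟩
  have hproper : ∀ N : Subgroup X, N.Normal → N ≠ ⊤ → Group.IsSolvable N := by
    intro N hN hne
    by_contra hs
    have hle : N.map X.subtype ≤ X := map_subtype_le N
    have h1 : X ≤ N.map X.subtype := hmin ⟨hN.isSubnormal.trans' hXs, fun h => hs <|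
      Group.isSolvable_of_isSolvable_injective
        (f := (N.equivMapOfInjective _ X.subtype_injective).toMonoidHom)
        (N.equivMapOfInjective _ X.subtype_injective).injective⟩ hle
    refine hne (map_injective X.subtype_injective ?_)
    rw [← MonoidHom.range_eq_map, range_subtype]
    exact le_antisymm hle h1
  have hperf : Group.IsPerfect X := by
    rw [Group.isPerfect_def]
    by_contra hne
    have := hproper _ inferInstance hne
    exact hXn (Group.isSolvable_of_ker_le_range (commutator X).subtype
      (Abelianization.of (G := X)) (by rw [Abelianization.ker_of, range_subtype]))
  have : Nontrivial X := by
    by_contra h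
    have := not_nontrivial_iff_subsingleton.mp h
    exact hXn inferInstance
  have hXc := hK.subgroup X
  have hX2 := pCore_eq_bot_of_isSubnormal h2 hXs
  exact ⟨X, hXs, (isQuasisimple_of_forall_isSolvable hperf hXc hX2 hproper).isSimpleGroup hXc hX2⟩

/-! ### The subgroup generated by the simple components -/

theorem map_mem_simpleComponents {A B : Type*} [Group A] [Group B] {L : Subgroup A} {f : A →* B}
    (hf : Function.Injective f) (hs : (L.map f).IsSubnormal) (hL : IsSimpleGroup L)
    (hL' : ¬ Group.IsSolvable L) : L.map f ∈ simpleComponents B := by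
  let e := L.equivMapOfInjective f hf
  exact ⟨hs, e.symm.isSimpleGroup, fun h => hL' <|
    Group.isSolvable_of_isSolvable_injective (f := e.toMonoidHom) e.injective⟩

instance sSup_simpleComponents_characteristic (K : Type*) [Group K] :
    (sSup (simpleComponents K)).Characteristic :=
  characteristic_iff_map_le.mpr fun e => by
    rw [sSup_eq_iSup', Subgroup.map_iSup, ← sSup_eq_iSup']
    exact iSup_le fun L => le_sSup <|
      map_mem_simpleComponents e.injective (L.2.1.map e.surjective) L.2.2.1 L.2.2.2

theorem inf_centralizer_eq_bot_of_mem_simpleComponents {K : Type*} [Group K] {T : Subgroup K}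
    (hT : T ∈ simpleComponents K) : T ⊓ centralizer (T : Set K) = ⊥ := by
  have := hT.2.1
  rcases Normal.eq_bot_or_eq_top (inferInstance : (center T).Normal) with h | h
  · rw [eq_bot_iff]
    rintro x ⟨hx, hc⟩
    have : (⟨x, hx⟩ : T) ∈ center T := mem_center_iff.mpr fun y =>
      Subtype.ext (mem_centralizer_iff.mp hc y y.2)
    rw [h, mem_bot] at this
    exact congrArg Subtype.val this
  · exact absurd (Group.isSolvable_of_comm fun a b =>
      mem_center_iff.mp (h ▸ mem_top b : b ∈ center T) a) hT.2.2

theorem layerSubgroup_centralizer_eq_bot {K : Type*} [Group K] [Finite K]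
    (hK : OddPSubgroupsCyclic K) (h2 : pCore 2 K = ⊥) :
    layerSubgroup (centralizer ((sSup (simpleComponents K) : Subgroup K) : Set K)) = ⊥ := by
  set C := centralizer ((sSup (simpleComponents K) : Subgroup K) : Set K)
  have hCs : C.IsSubnormal := (inferInstance : C.Normal).isSubnormal
  have hC2 := pCore_eq_bot_of_isSubnormal h2 hCs
  refine sSup_eq_bot.mpr ?_
  rintro L ⟨hLs, hLq⟩
  have hL := hLq.isSimpleGroup ((hK.subgroup C).subgroup L) (pCore_eq_bot_of_isSubnormal hC2 hLs)
  have hmem := map_mem_simpleComponents C.subtype_injective (hLs.trans' hCs) hL.1 hL.2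
  -- L is one of the components generating E, so C centralizes it; as L ≤ C, L centralizes itself.
  have hle : L.map C.subtype ≤ centralizer (L.map C.subtype : Set K) :=
    (map_subtype_le L).trans (centralizer_le (le_sSup hmem))
  have := inf_centralizer_eq_bot_of_mem_simpleComponents hmem
  rw [inf_eq_left.mpr hle] at this
  exact (map_eq_bot_iff_of_injective _ C.subtype_injective).mp this

theorem isCyclic_and_odd_card_genFittingSubgroup {K : Type*} [Group K] [Finite K]
    (hK : OddPSubgroupsCyclic K) (h2 : pCore 2 K = ⊥) :
    let C := centralizer ((sSup (simpleComponents K) : Subgroup K) : Set K)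
    IsCyclic (genFittingSubgroup C) ∧ Odd (Nat.card (genFittingSubgroup C)) := by
  intro C
  have hC2 := pCore_eq_bot_of_isSubnormal h2 (inferInstance : C.Normal).isSubnormal
  rw [genFittingSubgroup, layerSubgroup_centralizer_eq_bot hK h2, sup_bot_eq]
  exact isCyclic_and_odd_card_fittingSubgroup (hK.subgroup C) hC2

/-! ### Common prime divisors of commuting subgroups -/

theorem not_disjoint_zpowers_of_commute {K : Type*} [Group K] {p : ℕ} [Fact p.Prime]
    (hK : ∀ P : Subgroup K, IsPGroup p P → IsCyclic P) {x y : K} (hx : orderOf x = p)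
    (hy : orderOf y = p) (hxy : Commute x y) : ¬ Disjoint (zpowers x) (zpowers y) := by
  intro hd
  let f := (zpowers x).subtype.noncommCoprod (zpowers y).subtype fun a b => by
    obtain ⟨a, k, rfl⟩ := a
    obtain ⟨b, l, rfl⟩ := b
    exact (hxy.zpow_zpow k l)
  have hf : Function.Injective f := (MonoidHom.noncommCoprod_injective _ _ _).mpr
    ⟨subtype_injective _, subtype_injective _, by simpa using hd⟩
  have hcard : Nat.card f.range = p ^ 2 := by
    rw [← Nat.card_congr (MonoidHom.ofInjective hf).toEquiv, Nat.card_prod, Nat.card_zpowers,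
      Nat.card_zpowers, hx, hy, sq]
  have := hK _ (IsPGroup.of_card hcard)
  have hprod := (MonoidHom.ofInjective hf).isCyclic.mpr this
  have hfin (z : K) (hz : orderOf z = p) : Finite (zpowers z) :=
    Nat.finite_of_card_ne_zero (by rw [Nat.card_zpowers, hz]; exact (Fact.out : p.Prime).ne_zero)
  have := hfin x hx
  have := hfin y hy
  have hcop := coprime_card_of_isCyclic_prod (zpowers x) (zpowers y)
  rw [Nat.card_zpowers, Nat.card_zpowers, hx, hy, Nat.coprime_self] at hcop
  exact (Fact.out : p.Prime).one_lt.ne' hcop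

theorem exists_gcd_card_eq_two_pow {K : Type*} [Group K] [Finite K]
    (hK : OddPSubgroupsCyclic K) {A B : Subgroup K} (hAB : A ≤ centralizer (B : Set K))
    (hd : Disjoint A B) : ∃ b : ℕ, Nat.gcd (Nat.card A) (Nat.card B) = 2 ^ b := by
  refine ⟨_, Nat.eq_prime_pow_of_unique_prime_dvd (Nat.gcd_pos_of_pos_left _ Nat.card_pos).ne'
    fun {p} hp hdvd => ?_⟩
  by_contra hp2
  have := Fact.mk hp
  obtain ⟨x, hx⟩ := exists_prime_orderOf_dvd_card' p (hdvd.trans (Nat.gcd_dvd_left _ _))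
  obtain ⟨y, hy⟩ := exists_prime_orderOf_dvd_card' p (hdvd.trans (Nat.gcd_dvd_right _ _))
  rw [← orderOf_coe] at hx hy
  refine not_disjoint_zpowers_of_commute (hK p hp hp2) hx hy
    (mem_centralizer_iff.mp (hAB x.2) y y.2).symm ?_
  exact hd.mono (zpowers_le.mpr x.2) (zpowers_le.mpr y.2)

/-! ### Independence of the components, and the conjugation action -/

section InternalProduct

variable {K : Type*} [Group K] {ι : Type*} {H : ι → Subgroup K}

theorem iSupIndep_of_mem_simpleComponents (hH : ∀ i, H i ∈ simpleComponents K)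
    (hinj : Function.Injective H) : iSupIndep H := by
  intro i
  rw [disjoint_iff, eq_bot_iff, ← inf_centralizer_eq_bot_of_mem_simpleComponents (hH i)]
  refine inf_le_inf le_rfl (iSup₂_le fun j hj => ?_)
  exact commutator_eq_bot_iff_le_centralizer.mp
    (commutator_eq_bot_of_mem_simpleComponents (hH j) (hH i) (hinj.ne hj))

theorem pairwise_commute_of_mem_simpleComponents (hH : ∀ i, H i ∈ simpleComponents K)
    (hinj : Function.Injective H) :
    Pairwise fun i j => ∀ x y : K, x ∈ H i → y ∈ H j → Commute x y := by
  intro i j hij x y hx hy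
  have := commutator_eq_bot_iff_le_centralizer.mp
    (commutator_eq_bot_of_mem_simpleComponents (hH i) (hH j) (hinj.ne hij))
  exact (mem_centralizer_iff.mp (this hx) y hy).symm

end InternalProduct

/-- If `E` is a normal subgroup of `K`, then `K / E C_K(E)` embeds into `Out(E)`. -/
theorem ker_mulAut_conjNormal_mod_inn {K P : Type*} [Group K] [Group P] (E : Subgroup K)
    [E.Normal] (e : E ≃* P) :
    ((QuotientGroup.mk' (innSubgroup P)).comp
      ((MulAut.congr e).toMonoidHom.comp (MulAut.conjNormal (H := E)))).ker =
      centralizer (E : Set K) ⊔ E := by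
  ext x
  rw [MonoidHom.mem_ker, MonoidHom.comp_apply, QuotientGroup.mk'_apply, QuotientGroup.eq_one_iff,
    mem_sup_of_normal_right]
  constructor
  · rintro ⟨q, hq⟩
    -- If x acts on E as conjugation by q, then x q⁻¹ centralizes E.
    refine ⟨x * ((e.symm q : E) : K)⁻¹, ?_, e.symm q, SetLike.coe_mem _, by group⟩
    rw [mem_centralizer_iff]
    intro y hy
    -- The argument is chosen so that conjugation by `q` returns `e ⟨y, hy⟩`.
    have h1 := DFunLike.congr_fun hq
      (e ((e.symm q)⁻¹ * ⟨y, hy⟩ * e.symm q))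
    have h2 : q * e ((e.symm q)⁻¹ * ⟨y, hy⟩ * e.symm q) * q⁻¹ = e ⟨y, hy⟩ := by
      simp [mul_assoc]
    rw [MulAut.conj_apply, h2] at h1
    have h3 : (⟨y, hy⟩ : E) = MulAut.conjNormal x ((e.symm q)⁻¹ * ⟨y, hy⟩ * e.symm q) :=
      e.injective (by simpa [MulAut.congr] using h1)
    have h4 := congrArg Subtype.val h3
    rw [MulAut.conjNormal_apply] at h4
    push_cast at h4
    calc y * (x * ((e.symm q : E) : K)⁻¹)
        = (x * (((e.symm q : E) : K)⁻¹ * y * (e.symm q : E)) * x⁻¹) *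
            (x * ((e.symm q : E) : K)⁻¹) := by rw [← h4]
      _ = x * ((e.symm q : E) : K)⁻¹ * y := by group
  · rintro ⟨c, hc, z, hz, rfl⟩
    refine ⟨e ⟨z, hz⟩, ?_⟩
    ext q
    obtain ⟨y, rfl⟩ := e.surjective q
    rw [MulAut.conj_apply, ← map_inv, ← map_mul, ← map_mul]
    have : MulAut.conjNormal (c * z) y = ⟨z, hz⟩ * y * ⟨z, hz⟩⁻¹ := by
      ext
      rw [MulAut.conjNormal_apply]
      push_cast
      have h1 := mem_centralizer_iff.mp hc (z * y * z⁻¹)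
        (mul_mem (mul_mem hz y.2) (inv_mem hz))
      rw [mul_inv_rev]
      calc c * z * (y : K) * (z⁻¹ * c⁻¹) = (c * (z * y * z⁻¹)) * c⁻¹ := by group
        _ = z * y * z⁻¹ := by rw [← h1]; group
    simp [MulAut.congr, ← this]

/-! ### Assembling the normal subgroup -/

theorem exists_normal_prod_simple {K : Type u} [Group K] [Finite K]
    (hK : OddPSubgroupsCyclic K) (h2 : pCore 2 K = ⊥) (hns : ¬ Group.IsSolvable K) :
    ∃ (N : Subgroup K) (_ : N.Normal)
      (M : Type u) (_ : Group M) (k : ℕ) (T : Fin k → Type u) (_ : ∀ i, Group (T i)),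
      Nonempty (N ≃* M × (∀ i, T i)) ∧
      IsCyclic (genFittingSubgroup M) ∧ Odd (Nat.card (genFittingSubgroup M)) ∧
      0 < k ∧
      (∀ i, IsSimpleGroup (T i) ∧ ¬ ∀ x y : T i, x * y = y * x) ∧
      (∀ i j, i ≠ j → ∃ b : ℕ, Nat.gcd (Nat.card (T i)) (Nat.card (T j)) = 2 ^ b) ∧
      ∃ H : Subgroup (OutGroup (∀ i, T i)), Nonempty ((K ⧸ N) ≃* H) := by
  obtain ⟨k, ⟨e⟩⟩ := Finite.exists_equiv_fin (simpleComponents K)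
  let H : Fin k → Subgroup K := fun i => (e.symm i).1
  have hH (i) : H i ∈ simpleComponents K := (e.symm i).2
  have hinj : Function.Injective H := Subtype.val_injective.comp e.symm.injective
  have hsup : ⨆ i, H i = sSup (simpleComponents K) := by
    rw [sSup_eq_iSup']
    exact e.symm.iSup_comp (g := fun L : simpleComponents K => L.1)
  set E := sSup (simpleComponents K)
  have hind := iSupIndep_of_mem_simpleComponents hH hinj
  have hcomm := pairwise_commute_of_mem_simpleComponents hH hinj
  let ψ : (∀ i, H i) →* K := noncommPiCoprod hcomm
  have hψ : Function.Injective ψ := injective_noncommPiCoprod_of_iSupIndep hind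
  have hψr : ψ.range = E := noncommPiCoprod_range.trans hsup
  let ε : E ≃* (∀ i, H i) := (MulEquiv.subgroupCongr hψr.symm).trans (MonoidHom.ofInjective hψ).symm
  let C := centralizer (E : Set K)
  have hdisj : Disjoint C E := by
    rw [disjoint_iff, eq_bot_iff]
    rintro x ⟨hxC, hxE⟩
    rw [← hψr] at hxE
    obtain ⟨t, rfl⟩ := hxE
    suffices t = 1 by rw [this, map_one]; exact one_mem _
    ext i
    have hc : (t i : K) ∈ H i ⊓ centralizer (H i : Set K) := by
      refine ⟨(t i).2, mem_centralizer_iff.mpr fun y hy => ?_⟩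
      -- Commuting with elements supported in coordinate `i` forces `t i` to centralize `H i`.
      have h1 := mem_centralizer_iff.mp hxC (ψ (Pi.mulSingle i ⟨y, hy⟩))
        (hψr ▸ MonoidHom.mem_range.mpr ⟨_, rfl⟩)
      rw [← map_mul, ← map_mul] at h1
      have h2 := congrFun (hψ h1) i
      simpa using congrArg Subtype.val h2
    rw [inf_centralizer_eq_bot_of_mem_simpleComponents (hH i)] at hc
    exact hc
  let φ := C.subtype.noncommCoprod ψ fun c t =>
    (mem_centralizer_iff.mp c.2 (ψ t) (hψr ▸ MonoidHom.mem_range.mpr ⟨t, rfl⟩)).symm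
  have hφ : Function.Injective φ := (MonoidHom.noncommCoprod_injective _ _ _).mpr
    ⟨subtype_injective _, hψ, by rwa [range_subtype, hψr]⟩
  have hφr : φ.range = C ⊔ E := by
    refine (MonoidHom.noncommCoprod_range _ _ _).trans ?_
    rw [range_subtype, hψr]
  have hgen := isCyclic_and_odd_card_genFittingSubgroup hK h2
  let f := (QuotientGroup.mk' (innSubgroup (∀ i, H i))).comp
      ((MulAut.congr ε).toMonoidHom.comp (MulAut.conjNormal (H := E)))
  have hf : f.ker = C ⊔ E := ker_mulAut_conjNormal_mod_inn E ε
  refine ⟨C ⊔ E, sup_normal C E, C, inferInstance, k, fun i => H i, inferInstance,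
    ⟨(MulEquiv.subgroupCongr hφr.symm).trans (MonoidHom.ofInjective hφ).symm⟩, hgen.1, hgen.2,
    ?_, fun i => ⟨(hH i).2.1, fun h => (hH i).2.2 (Group.isSolvable_of_comm h)⟩, ?_,
    f.range, ⟨(QuotientGroup.quotientMulEquivOfEq hf.symm).trans
      (QuotientGroup.quotientKerEquivRange f)⟩⟩
  · obtain ⟨L, hL⟩ := simpleComponents_nonempty hK h2 hns
    exact (e ⟨L, hL⟩).pos
  · intro i j hij
    exact exists_gcd_card_eq_two_pow hK (commutator_eq_bot_iff_le_centralizer.mp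
      (commutator_eq_bot_of_mem_simpleComponents (hH i) (hH j) (hinj.ne hij)))
      (hind.pairwiseDisjoint hij)

theorem not_isSolvable_quotient_pCore {G : Type*} [Group G] [Finite G] {p : ℕ} [Fact p.Prime]
    (hG : ¬ Group.IsSolvable G) : ¬ Group.IsSolvable (G ⧸ pCore p G) := fun _ => hG <| by
  have := (isPGroup_pCore p G).isNilpotent
  have : Group.IsSolvable (pCore p G) := IsNilpotent.to_isSolvable
  exact Group.isSolvable_of_ker_le_range (pCore p G).subtype (QuotientGroup.mk' (pCore p G))
    (by rw [QuotientGroup.ker_mk', range_subtype])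

theorem proposition4p1 {G : Type u} [Group G] [Finite G] (hG : ¬ Group.IsSolvable G)
    (g h : G) (m n : ℕ) (hgh : IsTwoMNGroup g h m n)
    (a : ℕ) (hχ : eulerCharTwoMN G m n = 2 ^ a ∨ eulerCharTwoMN G m n = -2 ^ a) :
    ∃ (N : Subgroup (G ⧸ pCore 2 G)) (_ : N.Normal)
      (M : Type u) (_ : Group M) (k : ℕ) (T : Fin k → Type u) (_ : ∀ i, Group (T i)),
      Nonempty (N ≃* M × (∀ i, T i)) ∧
      IsCyclic (genFittingSubgroup M) ∧ Odd (Nat.card (genFittingSubgroup M)) ∧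
      0 < k ∧
      (∀ i, IsSimpleGroup (T i) ∧ ¬ ∀ x y : T i, x * y = y * x) ∧
      (∀ i j, i ≠ j → ∃ b : ℕ, Nat.gcd (Nat.card (T i)) (Nat.card (T j)) = 2 ^ b) ∧
      ∃ H : Subgroup (OutGroup (∀ i, T i)), Nonempty (((G ⧸ pCore 2 G) ⧸ N) ≃* H) :=
  exists_normal_prod_simple
    ((hgh.oddPSubgroupsCyclic hχ).of_surjective _ (QuotientGroup.mk'_surjective (pCore 2 G)))
    pCore_quotient_pCore (not_isSolvable_quotient_pCore hG)
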